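/- Let $n \ge 2$, let $F_n$ be the free group on $x_1, \dots, x_n$, and let $\varphi$ be a virtually inner automorphism of $F_n$, meaning that $\varphi^m$ is an inner automorphism for some integer $m \ge 1$. Let $F_n(t) = F_n \rtimes \langle t \rangle$ be a split extension of $F_n$ by a cyclic group $\langle t \rangle$ of finite or infinite order in which $t^{-1} f t = \varphi(f)$ for all $f \in F_n$. Then the conjugacy problem is solvable in $F_n(t)$: there is an algorithm that decides, for any two words in the letters $x_1^{\pm 1}, \dots, x_n^{\pm 1}, t^{\pm 1}$, whether the elements of $F_n(t)$ that they represent are conjugate in $F_n(t)$. Moreover, there is a computable conjugacy normal form: an algorithm that assigns to every such word $w$ a word $\overline{w}$ in the same letters, representing an element conjugate to the one represented by $w$, such that two words $u$ and $v$ represent conjugate elements if and only if $\overline{u}$ and $\overline{v}$ are the same word. -/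

import Mathlib

/-- An automorphism `φ` of a group is virtually inner if `φ ^ m` is inner for some `m ≥ 1`. -/
def IsVirtuallyInner {F : Type*} [Group F] (φ : MulAut F) : Prop :=
  ∃ m : ℕ, 0 < m ∧ φ ^ m ∈ (MulAut.conj : F →* MulAut F).range

/-- Words in the letters `s i` and `(s i)⁻¹`: the pair `(i, true)` is the letter `s i`, and
`(i, false)` is its formal inverse. Words need not be reduced. -/
abbrev GroupWord (ι : Type*) : Type _ := List (ι × Bool)

/-- The element of `G` that a word in the family `s` represents. -/
def GroupWord.val {G : Type*} [Group G] {ι : Type*} (s : ι → G) (w : GroupWord ι) : G :=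
  (w.map fun a => cond a.2 (s a.1) (s a.1)⁻¹).prod

/-- The conjugacy problem of `G` with respect to the generating family `s` is solvable: some
algorithm decides, for any two words, whether the elements they represent are conjugate in `G`. -/
def ConjugacyProblemSolvable {G : Type*} [Group G] {ι : Type*} [Primcodable ι] (s : ι → G) :
    Prop :=
  ComputablePred fun p : GroupWord ι × GroupWord ι => IsConj (p.1.val s) (p.2.val s)

/-- `nf` is a computable conjugacy normal form: an algorithm that sends each word to a word
representing a conjugate element, such that two words represent conjugate elements if and only if
they are sent to the same word. -/
def IsComputableConjugacyNormalForm {G : Type*} [Group G] {ι : Type*} [Primcodable ι]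
    (s : ι → G) (nf : GroupWord ι → GroupWord ι) : Prop :=
  Computable nf ∧
  (∀ w, IsConj (w.val s) ((nf w).val s)) ∧
  ∀ u v, IsConj (u.val s) (v.val s) ↔ nf u = nf v

/-- The standard generators `x₁, …, xₙ, t` of `Fₙ ⋊ ⟨t⟩`: `some i` stands for the free
generator `xᵢ`, and `none` stands for `t`. -/
def splitExtensionGen {n : ℕ} {C : Type*} [Group C] (θ : C →* MulAut (FreeGroup (Fin n)))
    (t : C) : Option (Fin n) → FreeGroup (Fin n) ⋊[θ] C
  | some i => SemidirectProduct.inl (FreeGroup.of i)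
  | none => SemidirectProduct.inr t

/-! Every element has the form `t ^ k * f`, and conjugating by `t ^ j * g` turns conjugacy into a
condition on exponents together with the twisted equation `(φ ^ j) f * g = (φ ^ l) g * f'`. The core
of the proof is that a solvable equation has a solution of size linear in `f`, `f'` and `l`.
Conjugacy is then decided by testing all short words with the word problem, and a normal form is the
conjugate word of least code.

Let `ψ ^ p` be `x ↦ h⁻¹ * x * h` with `ψ h = h`, and let `T x = f⁻¹ * ψ x`. Then `T^[p] x = u * x *
h` with `u = T^[p] 1 * h⁻¹`, and twisting `f` by `g` replaces `u` by `g⁻¹ * u * g`.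

If `u ≠ 1`, then `ψ u = f * u * f⁻¹` lets `g` be multiplied on the left by powers of `u`, and in a
tree some `u ^ k * g` is short (`exists_zpow_mul_norm_le`).

If `u = 1`, the `T`-orbit of `1` is periodic up to right translation by `h`. By bounded
cancellation, `ψ` almost preserves a norm that is almost additive along geodesics. For this norm a
quasi-centre `g` of the orbit is moved by `T` only a bounded distance, so `(ψ g)⁻¹ * f * g` lies in
a fixed finite ball (`exists_norm_twisted_conj_le`). Inside the ball finitely many conjugators
suffice.

Arbitrary exponents `j` and `l` reduce modulo `m`, the powers of `h` being absorbed into `g`, `f`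
and `f'`. -/

/-- The length of the longest common prefix of two lists. -/
def List.commonPrefixLength {β : Type*} [DecidableEq β] : List β → List β → ℕ
  | a :: l, b :: m => if a = b then commonPrefixLength l m + 1 else 0
  | [], _ => 0
  | _ :: _, [] => 0

/-- On reduced words the common prefix length is the Gromov product based at `1`; this ultrametric
inequality is what makes the Cayley tree `0`-hyperbolic. -/
theorem List.min_commonPrefixLength_le {β : Type*} [DecidableEq β] (l₁ l₂ l₃ : List β) :
    min (l₁.commonPrefixLength l₂) (l₂.commonPrefixLength l₃) ≤ l₁.commonPrefixLength l₃ := by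
  induction l₁ generalizing l₂ l₃ with
  | nil => simp [commonPrefixLength]
  | cons a l ih =>
    cases l₂ with
    | nil => simp [commonPrefixLength]
    | cons b m =>
      cases l₃ with
      | nil => simp [commonPrefixLength]
      | cons c k =>
        have := ih m k
        simp only [commonPrefixLength]
        split_ifs <;> simp_all

/-! ### Tree geometry of the word norm -/

namespace FreeGroup

variable {α : Type*} [DecidableEq α]

theorem isReduced_invRev {L : List (α × Bool)} (h : IsReduced L) : IsReduced (invRev L) := by
  rw [isReduced_iff_reduce_eq] at *
  rw [reduce_invRev, h]

theorem length_reduce_invRev_append {L₁ L₂ : List (α × Bool)} (h₁ : IsReduced L₁)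
    (h₂ : IsReduced L₂) :
    (reduce (invRev L₁ ++ L₂)).length + 2 * L₁.commonPrefixLength L₂ =
      L₁.length + L₂.length := by
  induction L₁ generalizing L₂ with
  | nil => simp [List.commonPrefixLength, h₂.reduce_eq]
  | cons a l ih =>
    cases L₂ with
    | nil => simp [List.commonPrefixLength, (isReduced_invRev h₁).reduce_eq]
    | cons b m =>
      simp only [List.commonPrefixLength]
      split_ifs with hab
      · subst hab
        have := ih (h₁.infix (List.suffix_cons _ _).isInfix) (h₂.infix (List.suffix_cons _ _).isInfix)
        have h : reduce (invRev (a :: l) ++ a :: m) = reduce (invRev l ++ m) := by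
          apply reduce.sound
          have e (k : List (α × Bool)) : mk (a :: k) = mk [a] * mk k := by simp
          rw [← mul_mk, ← mul_mk, ← inv_mk, ← inv_mk, e l, e m, mul_inv_rev, mul_assoc,
            inv_mul_cancel_left]
        rw [h]
        simp only [List.length_cons]
        omega
      · have h : IsReduced (invRev (a :: l) ++ b :: m) := by
          unfold IsReduced
          rw [List.isChain_append]
          refine ⟨isReduced_invRev h₁, h₂, ?_⟩
          rintro x hx y hy
          simp [invRev] at hx hy
          subst hx hy
          intro h1
          simp only at h1 ⊢
          rcases a with ⟨a, s⟩
          rcases b with ⟨b, t⟩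
          simp only at h1
          subst h1
          cases s <;> cases t <;> simp_all
        rw [h.reduce_eq]
        simp

theorem norm_inv_mul_add (a b : FreeGroup α) :
    (a⁻¹ * b).norm + 2 * a.toWord.commonPrefixLength b.toWord = a.norm + b.norm := by
  have := length_reduce_invRev_append (isReduced_toWord (x := a)) (isReduced_toWord (x := b))
  rwa [← toWord_inv, ← toWord_mul] at this

theorem norm_inv_mul_comm (a b : FreeGroup α) : (a⁻¹ * b).norm = (b⁻¹ * a).norm := by
  rw [← norm_inv_eq]; simp

/-- The four-point condition for the word metric: the Cayley tree is `0`-hyperbolic. -/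
theorem norm_four_point (a b c : FreeGroup α) :
    (a⁻¹ * c).norm + b.norm ≤ c.norm + (a⁻¹ * b).norm ∨
      (a⁻¹ * c).norm + b.norm ≤ a.norm + (b⁻¹ * c).norm := by
  have h₁ := norm_inv_mul_add a b
  have h₂ := norm_inv_mul_add b c
  have h₃ := norm_inv_mul_add a c
  have h₄ := List.min_commonPrefixLength_le a.toWord b.toWord c.toWord
  omega

/-- The point `c * p` lies on the geodesic from `c` to `c * p * s`. In a tree it therefore lies on
the geodesic from `1` to one of the two ends. -/
theorem norm_eq_add_or_norm_eq_add {p s : FreeGroup α} (h : (p * s).norm = p.norm + s.norm)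
    (c : FreeGroup α) :
    c.norm = (c * p).norm + p.norm ∨ (c * p * s).norm = (c * p).norm + s.norm := by
  have h₁ := norm_four_point c (c * p) (c * p * s)
  have h₂ := norm_mul_le (c * p) s
  have h₃ := norm_mul_le (c * p) p⁻¹
  have e₁ : c⁻¹ * (c * p * s) = p * s := by group
  have e₂ : c⁻¹ * (c * p) = p := by group
  have e₃ : (c * p)⁻¹ * (c * p * s) = s := by group
  rw [e₁, e₂, e₃] at h₁
  rw [mul_inv_cancel_right, norm_inv_eq] at h₃
  omega

/-- Writing `u` as a reduced conjugate of a nonempty cyclically reduced word, squaring repeats only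
the core, so the norm grows by the length of the core. -/
theorem norm_lt_norm_mul_self {u : FreeGroup α} (hu : u ≠ 1) : u.norm < (u * u).norm := by
  have h₁ := reduceCyclically.reduce_flatten_replicate_succ (isReduced_toWord (x := u)) 1
  have h₂ := reduceCyclically.conj_conjugator_reduceCyclically u.toWord
  have h₃ : reduceCyclically u.toWord ≠ [] := by
    intro h
    apply hu
    rw [h, List.append_nil] at h₂
    rw [← mk_toWord (x := u), ← h₂, ← mul_mk, ← inv_mk, mul_inv_cancel]
  have h₄ := List.length_pos_iff.2 h₃
  have h₅ := congrArg List.length h₁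
  have h₆ := congrArg List.length h₂
  simp [norm, toWord_mul, List.replicate_succ] at *
  omega

/-- Take `x = u ^ k * g` of least norm, so `u * x = x * v`. If `x` were longer than the bound, one
four-point condition would force `u * x` and `u⁻¹ * x` to have the same norm as `x`, and another
would then give `(u * u).norm ≤ u.norm`. -/
theorem exists_zpow_mul_norm_le {u v g : FreeGroup α} (hu : u ≠ 1) (h : u * g = g * v) :
    ∃ k : ℤ, (u ^ k * g).norm ≤ u.norm + v.norm := by
  obtain ⟨k, hk⟩ : ∃ k : ℤ, ∀ j : ℤ, (u ^ k * g).norm ≤ (u ^ j * g).norm :=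
    ⟨_, fun j => Function.argmin_le (fun k : ℤ => (u ^ k * g).norm) j⟩
  refine ⟨k, ?_⟩
  have h₁ := hk (k + 1)
  have h₂ := hk (k - 1)
  have e₁ : u ^ (k + 1) * g = u * (u ^ k * g) := by rw [zpow_add]; group
  have e₂ : u ^ (k - 1) * g = u⁻¹ * (u ^ k * g) := by group
  have e₃ : u * (u ^ k * g) = (u ^ k * g) * v := by
    rw [mul_assoc, ← h]; group
  simp only [e₁, e₂] at h₁ h₂
  generalize u ^ k * g = x at *
  by_contra! hlt
  have h₃ := norm_four_point u (u * x) x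
  have h₄ := norm_four_point u x u⁻¹
  have h₅ := norm_lt_norm_mul_self hu
  have e₄ : u⁻¹ * (u * x) = x := by group
  have e₅ : ((u * x)⁻¹ * x).norm = v.norm := by
    rw [e₃, ← norm_inv_eq]; simp
  have e₆ : (u⁻¹ * u⁻¹).norm = (u * u).norm := by
    rw [← norm_inv_eq]; simp
  have e₇ : (x⁻¹ * u⁻¹).norm = (u * x).norm := by
    rw [← norm_inv_eq]; simp
  rw [e₄, e₅] at h₃
  rw [e₆, e₇, norm_inv_eq] at h₄
  omega

/-- The prefix of length `k` of the reduced word of `x`. -/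
def prefixOf (x : FreeGroup α) (k : ℕ) : FreeGroup α := mk (x.toWord.take k)

/-- What remains of the reduced word of `x` after its prefix of length `k`. -/
def suffixOf (x : FreeGroup α) (k : ℕ) : FreeGroup α := mk (x.toWord.drop k)

theorem prefixOf_mul_suffixOf (x : FreeGroup α) (k : ℕ) : x.prefixOf k * x.suffixOf k = x := by
  rw [prefixOf, suffixOf, mul_mk, List.take_append_drop, mk_toWord]

theorem norm_prefixOf {x : FreeGroup α} {k : ℕ} (hk : k ≤ x.norm) : (x.prefixOf k).norm = k := by
  rw [prefixOf, norm, toWord_mk, (isReduced_toWord.infix (List.take_prefix _ _).isInfix).reduce_eq]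
  exact List.length_take_of_le hk

theorem norm_suffixOf (x : FreeGroup α) (k : ℕ) : (x.suffixOf k).norm = x.norm - k := by
  rw [suffixOf, norm, toWord_mk, (isReduced_toWord.infix (List.drop_suffix _ _).isInfix).reduce_eq]
  simp [norm]

theorem norm_prefixOf_inv_mul_prefixOf_succ_le (x : FreeGroup α) (k : ℕ) :
    ((x.prefixOf k)⁻¹ * x.prefixOf (k + 1)).norm ≤ 1 := by
  rw [prefixOf, prefixOf, List.take_add_one, ← mul_mk, inv_mul_cancel_left]
  refine norm_mk_le.trans ?_
  cases x.toWord[k]? <;> simp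

theorem exists_norm_map_le [Finite α] (f : FreeGroup α →* FreeGroup α) :
    ∃ K : ℕ, ∀ x, (f x).norm ≤ K * x.norm := by
  have := Fintype.ofFinite α
  refine ⟨∑ i, (f (of i)).norm, fun x => ?_⟩
  have key (L : List (α × Bool)) : (f (mk L)).norm ≤ (∑ i, (f (of i)).norm) * L.length := by
    induction L with
    | nil => simp [← one_eq_mk]
    | cons a l ih =>
      have e : mk (a :: l) = mk [a] * mk l := by simp
      have h : (f (mk [a])).norm ≤ ∑ i, (f (of i)).norm := by
        have h₁ : (f (mk [a])).norm = (f (of a.1)).norm := by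
          rcases a with ⟨i, _ | _⟩
          · have : mk [(i, false)] = (of i)⁻¹ := rfl
            rw [this, _root_.map_inv, norm_inv_eq]
          · rfl
        rw [h₁]
        exact Finset.single_le_sum (f := fun i => (f (of i)).norm) (fun _ _ => Nat.zero_le _)
          (Finset.mem_univ _)
      rw [e, _root_.map_mul, List.length_cons, mul_add, mul_one, add_comm]
      exact (norm_mul_le _ _).trans (add_le_add h ih)
  simpa [mk_toWord, norm] using key x.toWord

/-! ### Bounded cancellation for automorphisms -/

section BoundedCancellation

variable {ψ : FreeGroup α ≃* FreeGroup α} {K : ℕ}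

/-- A discrete intermediate value argument: `p` is the first prefix whose image has Gromov product
at least `L / 2` with `ψ x`. One more letter moves the image by at most `K`, so `ψ p` cannot
overshoot depth `L / 2` by more than `K`. -/
theorem exists_prefix_map_near (hK : ∀ x, (ψ x).norm ≤ K * x.norm) (x : FreeGroup α) {L : ℕ}
    (hL : L ≤ 2 * (ψ x).norm) :
    ∃ p s, p * s = x ∧ p.norm + s.norm = x.norm ∧ L + (ψ s).norm ≤ (ψ x).norm + (ψ p).norm ∧
      2 * (ψ p).norm ≤ L + 2 * K := by
  classical
  have hex : ∃ k, k ≤ x.norm ∧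
      L + (ψ (x.suffixOf k)).norm ≤ (ψ x).norm + (ψ (x.prefixOf k)).norm := by
    refine ⟨x.norm, le_rfl, ?_⟩
    have h : x.suffixOf x.norm = 1 := by rw [← norm_eq_zero, norm_suffixOf, Nat.sub_self]
    have h' := prefixOf_mul_suffixOf x x.norm
    rw [h, mul_one] at h'
    rw [h, h']
    simpa [two_mul] using hL
  obtain ⟨hk, hk'⟩ := Nat.find_spec hex
  have hmin := fun j => Nat.find_min hex (m := j)
  generalize Nat.find hex = k at *
  refine ⟨x.prefixOf k, x.suffixOf k, prefixOf_mul_suffixOf x k, ?_, hk', ?_⟩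
  · rw [norm_prefixOf hk, norm_suffixOf]; omega
  rcases k with _ | j
  · have h : x.prefixOf 0 = 1 := by rw [← norm_eq_zero, norm_prefixOf (Nat.zero_le _)]
    rw [h]; simp
  · have h₁ := hmin j (Nat.lt_succ_self j)
    rw [not_and, not_le] at h₁
    replace h₁ := h₁ (by omega)
    have h₂ : ((ψ (x.prefixOf (j + 1)))⁻¹ * ψ (x.prefixOf j)).norm ≤ K := by
      rw [norm_inv_mul_comm, ← _root_.map_inv, ← _root_.map_mul]
      refine (hK _).trans ?_
      have := Nat.mul_le_mul_left K (norm_prefixOf_inv_mul_prefixOf_succ_le x j)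
      simpa using this
    have e (i : ℕ) : ((ψ x)⁻¹ * ψ (x.prefixOf i)).norm = (ψ (x.suffixOf i)).norm := by
      rw [norm_inv_mul_comm, ← _root_.map_inv, ← _root_.map_mul]
      congr 2
      rw [inv_mul_eq_iff_eq_mul, prefixOf_mul_suffixOf]
    have h₃ := norm_four_point (ψ x) (ψ (x.prefixOf (j + 1))) (ψ (x.prefixOf j))
    have h₄ := norm_mul_le (ψ (x.prefixOf j)) ((ψ (x.prefixOf j))⁻¹ * (ψ (x.prefixOf (j + 1))))
    rw [mul_inv_cancel_left, norm_inv_mul_comm] at h₄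
    rw [e, e] at h₃
    omega

/-- The bounded cancellation lemma. -/
theorem norm_map_add_norm_map_le (hK : ∀ x, (ψ x).norm ≤ K * x.norm)
    (hK' : ∀ x, (ψ.symm x).norm ≤ K * x.norm) {a b : FreeGroup α}
    (hab : (a * b).norm = a.norm + b.norm) :
    (ψ a).norm + (ψ b).norm ≤ (ψ (a * b)).norm + 4 * K ^ 3 := by
  -- `L` is twice the number of letters of `ψ b` that cancel against `ψ a`.
  obtain ⟨L, hL⟩ : ∃ L, (ψ a).norm + (ψ b).norm = (ψ (a * b)).norm + L := by
    rw [_root_.map_mul]; exact Nat.exists_eq_add_of_le (norm_mul_le _ _)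
  have ha := norm_mul_le (ψ a)⁻¹ (ψ (a * b))
  have hb := norm_mul_le (ψ (a * b)) (ψ b)⁻¹
  rw [_root_.map_mul, inv_mul_cancel_left, norm_inv_eq, ← _root_.map_mul] at ha
  rw [_root_.map_mul, mul_inv_cancel_right, norm_inv_eq, ← _root_.map_mul] at hb
  obtain ⟨p, s, hps, hps', hp, hp'⟩ := exists_prefix_map_near hK a⁻¹ (L := L)
    (by rw [_root_.map_inv, norm_inv_eq]; omega)
  obtain ⟨q, r, hqr, hqr', hq, hq'⟩ := exists_prefix_map_near hK b (L := L) (by omega)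
  have h₁ := norm_four_point (ψ p) (ψ a⁻¹) (ψ q)
  have h₂ := norm_four_point (ψ a⁻¹) (ψ b) (ψ q)
  have e₁ : (ψ p)⁻¹ * ψ a⁻¹ = ψ s := by rw [← hps, _root_.map_mul, inv_mul_cancel_left]
  have e₂ : ((ψ b)⁻¹ * ψ q).norm = (ψ r).norm := by
    rw [norm_inv_mul_comm, ← hqr, _root_.map_mul, inv_mul_cancel_left]
  have e₃ : (ψ a⁻¹)⁻¹ * ψ b = ψ (a * b) := by simp
  rw [e₁] at h₁
  rw [e₂, e₃] at h₂
  have e₄ : (ψ a⁻¹).norm = (ψ a).norm := by rw [_root_.map_inv, norm_inv_eq]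
  -- Both images are close to the point at depth `L / 2` where the geodesics to `ψ a⁻¹` and `ψ b`
  -- separate. Applying `ψ.symm` makes `p` and `q` close; as they point in different directions from
  -- `1`, both are short, and then so is `L`.
  have h₃ : ((ψ p)⁻¹ * ψ q).norm ≤ 2 * K := by omega
  have h₄ : (p⁻¹ * q).norm ≤ K * (2 * K) := by
    have h := hK' (ψ (p⁻¹ * q))
    rw [ψ.symm_apply_apply, _root_.map_mul, _root_.map_inv] at h
    exact h.trans (Nat.mul_le_mul_left K h₃)
  have h₅ : (a * b).norm ≤ s.norm + (p⁻¹ * q).norm + r.norm := by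
    have e : a * b = s⁻¹ * (p⁻¹ * q) * r := by
      rw [← hqr, ← inv_inv a, ← hps]; group
    rw [e]
    refine (norm_mul_le _ _).trans (Nat.add_le_add_right ((norm_mul_le _ _).trans ?_) _)
    rw [norm_inv_eq]
  rw [norm_inv_eq] at hps'
  have h₆ : q.norm ≤ K * (2 * K) := by omega
  have h₇ := (hK q).trans (Nat.mul_le_mul_left K h₆)
  have h₈ := norm_mul_le (ψ q) (ψ r)
  rw [← _root_.map_mul, hqr] at h₈
  have e : 4 * K ^ 3 = 2 * (K * (K * (2 * K))) := by ring
  omega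

end BoundedCancellation

end FreeGroup

/-! ### Quasi-centres in the Cayley tree -/

namespace FreeGroup

variable {α : Type*} [DecidableEq α]

/-- Quasi-centres of a finite family of points, with respect to a norm that is almost additive
along geodesics of the Cayley tree, are close to each other. -/
theorem norm_inv_mul_le_of_quasicenter {ι : Type*} {N : FreeGroup α → ℕ} {C C₁ : ℕ}
    (hN : ∀ x, x.norm ≤ N x)
    (hC : ∀ a b, (a * b).norm = a.norm + b.norm → N a + N b ≤ N (a * b) + C)
    {S : Finset ι} (hS : S.Nonempty) (a : ι → FreeGroup α) {g g' : FreeGroup α}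
    (hg : ∀ x, (S.sup fun i => N ((a i)⁻¹ * g)) ≤ S.sup fun i => N ((a i)⁻¹ * x))
    (hg' : (S.sup fun i => N ((a i)⁻¹ * g')) ≤ (S.sup fun i => N ((a i)⁻¹ * g)) + C₁) :
    (g⁻¹ * g').norm ≤ 2 * (C + C₁) + 1 := by
  obtain ⟨x, rfl⟩ : ∃ x, g' = g * x := ⟨g⁻¹ * g', by group⟩
  rw [inv_mul_cancel_left]
  have hp := norm_prefixOf (x := x) (k := x.norm / 2) (by omega)
  have hs := norm_suffixOf x (x.norm / 2)
  have hps := prefixOf_mul_suffixOf x (x.norm / 2)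
  generalize x.prefixOf (x.norm / 2) = p at *
  generalize x.suffixOf (x.norm / 2) = s at *
  -- Let `a i` be farthest from the midpoint `g * p`. The geodesic from `a i` to `g` or to `g * x`
  -- passes through this midpoint, so a long `x` would make that endpoint a worse centre than
  -- allowed.
  obtain ⟨i, hi, hsup⟩ := S.exists_mem_eq_sup hS fun i => N ((a i)⁻¹ * (g * p))
  have h₁ := hg (g * p)
  have h₂ : N ((a i)⁻¹ * g) ≤ S.sup fun i => N ((a i)⁻¹ * g) :=
    S.le_sup (f := fun i => N ((a i)⁻¹ * g)) hi
  have h₃ : N ((a i)⁻¹ * (g * x)) ≤ S.sup fun i => N ((a i)⁻¹ * (g * x)) :=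
    S.le_sup (f := fun i => N ((a i)⁻¹ * (g * x))) hi
  have h₄ := hN p
  have h₅ := hN s
  rw [← hps, ← mul_assoc, ← mul_assoc] at h₃
  rw [← mul_assoc] at hsup
  rcases norm_eq_add_or_norm_eq_add (p := p) (s := s) (by rw [hps]; omega) ((a i)⁻¹ * g)
    with h | h
  · have h₆ := hC ((a i)⁻¹ * g * p) p⁻¹ (by rw [mul_inv_cancel_right, norm_inv_eq, h])
    have h₇ := hN p⁻¹
    rw [norm_inv_eq] at h₇
    rw [mul_inv_cancel_right] at h₆
    omega
  · have h₆ := hC _ _ h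
    simp only [← hps] at hg'
    simp only [← mul_assoc] at *
    omega

end FreeGroup

/-! ### Affine maps and twisted conjugacy -/

namespace FreeGroup

variable {α : Type*}

section AffineMap

variable (ψ : MulAut (FreeGroup α)) (f : FreeGroup α)

/-- The affine map `x ↦ f⁻¹ * ψ x`, whose conjugates by left translations correspond to the
`ψ`-twisted conjugates of `f`. -/
def affineMap (x : FreeGroup α) : FreeGroup α := f⁻¹ * ψ x

theorem affineMap_iterate_mul (i : ℕ) (x y : FreeGroup α) :
    (affineMap ψ f)^[i] (x * y) = (affineMap ψ f)^[i] x * (ψ ^ i) y := by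
  induction i generalizing x y with
  | zero => simp
  | succ i ih =>
    have e : affineMap ψ f (x * y) = affineMap ψ f x * ψ y := by simp [affineMap, mul_assoc]
    rw [Function.iterate_succ_apply, e, ih, Function.iterate_succ_apply, pow_succ,
      MulAut.mul_apply]

theorem affineMap_iterate_twisted (g : FreeGroup α) (i : ℕ) (x : FreeGroup α) :
    (affineMap ψ ((ψ g)⁻¹ * f * g))^[i] x = g⁻¹ * (affineMap ψ f)^[i] (g * x) := by
  induction i generalizing x with
  | zero => simp
  | succ i ih =>
    rw [Function.iterate_succ_apply, ih, Function.iterate_succ_apply]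
    congr 2
    simp [affineMap, mul_assoc]

theorem affineMap_inv_mul (a b : FreeGroup α) :
    (affineMap ψ f a)⁻¹ * affineMap ψ f b = ψ (a⁻¹ * b) := by
  simp [affineMap, mul_assoc]

theorem affineMap_iterate_eq {ψ : MulAut (FreeGroup α)} {p : ℕ} {h : FreeGroup α}
    (f : FreeGroup α) (hψ : ∀ x, (ψ ^ p) x = h⁻¹ * x * h)
    (x : FreeGroup α) :
    (affineMap ψ f)^[p] x = (affineMap ψ f)^[p] 1 * h⁻¹ * x * h := by
  have := affineMap_iterate_mul ψ f p 1 x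
  rw [one_mul, hψ] at this
  rw [this]; group

/-- Obtained by evaluating at `1` the fact that the affine map commutes with its own iterate. It is
what allows a twisted conjugator of `f` to be multiplied on the left by powers of this element. -/
theorem map_affineMap_iterate_mul_inv {ψ : MulAut (FreeGroup α)} {p : ℕ} {h : FreeGroup α}
    (f : FreeGroup α) (hψ : ∀ x, (ψ ^ p) x = h⁻¹ * x * h)
    (hh : ψ h = h) :
    ψ ((affineMap ψ f)^[p] 1 * h⁻¹) = f * ((affineMap ψ f)^[p] 1 * h⁻¹) * f⁻¹ := by
  have h₁ := Function.iterate_succ_apply (affineMap ψ f) p 1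
  rw [Function.iterate_succ_apply', affineMap_iterate_eq f hψ (affineMap ψ f 1)] at h₁
  have e : affineMap ψ f 1 = f⁻¹ := by simp [affineMap]
  rw [e] at h₁
  generalize (affineMap ψ f)^[p] 1 = x at *
  rw [affineMap, inv_mul_eq_iff_eq_mul] at h₁
  rw [_root_.map_mul, _root_.map_inv, hh, h₁]
  group

end AffineMap

variable [DecidableEq α] (ψ : MulAut (FreeGroup α)) (f : FreeGroup α)

theorem norm_affineMap_iterate_one_le {K : ℕ} (hK : ∀ x, (ψ x).norm ≤ K * x.norm) (i : ℕ) :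
    ((affineMap ψ f)^[i] 1).norm ≤ i * (K + 1) ^ i * f.norm := by
  induction i with
  | zero => simp
  | succ i ih =>
    rw [Function.iterate_succ_apply', affineMap]
    have h₁ := hK ((affineMap ψ f)^[i] 1)
    have h₂ := norm_mul_le f⁻¹ (ψ ((affineMap ψ f)^[i] 1))
    rw [norm_inv_eq] at h₂
    have h₃ : K * ((affineMap ψ f)^[i] 1).norm ≤ (K + 1) * (i * (K + 1) ^ i * f.norm) :=
      Nat.mul_le_mul (Nat.le_succ K) ih
    have h₄ : 1 * f.norm ≤ (K + 1) ^ (i + 1) * f.norm :=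
      Nat.mul_le_mul_right _ (Nat.one_le_pow _ _ (Nat.succ_pos K))
    have e : (i + 1) * (K + 1) ^ (i + 1) * f.norm =
        (K + 1) ^ (i + 1) * f.norm + (K + 1) * (i * (K + 1) ^ i * f.norm) := by ring
    omega

variable {f} [Finite α]

theorem exists_norm_map_add_norm_map_le :
    ∃ C : ℕ, ∀ a b : FreeGroup α, (a * b).norm = a.norm + b.norm →
      (ψ a).norm + (ψ b).norm ≤ (ψ (a * b)).norm + C := by
  obtain ⟨K₁, hK₁⟩ := exists_norm_map_le ψ.toMonoidHom
  obtain ⟨K₂, hK₂⟩ := exists_norm_map_le ψ.symm.toMonoidHom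
  refine ⟨4 * (max K₁ K₂) ^ 3, fun a b hab => norm_map_add_norm_map_le (fun x => ?_)
    (fun x => ?_) hab⟩
  · exact (hK₁ x).trans (Nat.mul_le_mul_right _ (le_max_left _ _))
  · exact (hK₂ x).trans (Nat.mul_le_mul_right _ (le_max_right _ _))

variable {ψ} {p : ℕ} {h : FreeGroup α}

/-- If some power of `ψ` is inner, then the elements `f` for which the affine map of `f` is
periodic up to a fixed right translation are `ψ`-twisted conjugate to elements of bounded norm,
by conjugators of linearly bounded norm. -/
theorem exists_norm_twisted_conj_le (hp : 0 < p) (hψ : ∀ x, (ψ ^ p) x = h⁻¹ * x * h) :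
    ∃ A D : ℕ, ∀ f : FreeGroup α, (affineMap ψ f)^[p] 1 = h →
      ∃ g : FreeGroup α, g.norm ≤ A * f.norm ∧ ((ψ g)⁻¹ * f * g).norm ≤ D := by
  choose C hC using fun j => exists_norm_map_add_norm_map_le (ψ ^ j)
  choose K hK using fun j => exists_norm_map_le (ψ ^ j).toMonoidHom
  change ∀ j x, ((ψ ^ j) x).norm ≤ K j * x.norm at hK
  -- Summing over `p` powers makes the norm almost `ψ`-invariant: applying `ψ` shifts the sum and
  -- replaces the term of `x` by that of `h⁻¹ * x * h`.
  set N : FreeGroup α → ℕ := fun x => ∑ j ∈ Finset.range p, ((ψ ^ j) x).norm with hN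
  have hN₁ (x : FreeGroup α) : x.norm ≤ N x := by
    simpa using Finset.single_le_sum (f := fun j => ((ψ ^ j) x).norm)
      (fun _ _ => Nat.zero_le _) (Finset.mem_range.2 hp)
  have hN₂ (x y : FreeGroup α) : N (x * y) ≤ N x + N y := by
    simp only [hN, ← Finset.sum_add_distrib, _root_.map_mul]
    exact Finset.sum_le_sum fun j _ => norm_mul_le _ _
  have hN₃ (x : FreeGroup α) : N (ψ x) ≤ N x + 2 * h.norm := by
    have h₁ := Finset.sum_range_succ (fun j => ((ψ ^ j) x).norm) p
    have h₂ := Finset.sum_range_succ' (fun j => ((ψ ^ j) x).norm) p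
    have h₃ := norm_mul_le (h⁻¹ * x) h
    have h₄ := norm_mul_le h⁻¹ x
    rw [norm_inv_eq] at h₄
    simp only [pow_succ, MulAut.mul_apply, pow_zero, MulAut.one_apply] at h₂
    rw [hψ] at h₁
    simp only [hN]
    omega
  have hN₄ (x : FreeGroup α) : N x ≤ (∑ j ∈ Finset.range p, K j) * x.norm := by
    rw [Finset.sum_mul]
    exact Finset.sum_le_sum fun j _ => hK j x
  have hN₅ (a b : FreeGroup α) (hab : (a * b).norm = a.norm + b.norm) :
      N a + N b ≤ N (a * b) + ∑ j ∈ Finset.range p, C j := by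
    simp only [hN, ← Finset.sum_add_distrib]
    exact Finset.sum_le_sum fun j _ => hC j a b hab
  refine ⟨(∑ j ∈ Finset.range p, K j) * (p * (K 1 + 1) ^ p),
    2 * ((∑ j ∈ Finset.range p, C j) + (N h + 2 * h.norm)) + 1, fun f hf => ?_⟩
  set T := affineMap ψ f with hT
  set E : FreeGroup α → ℕ := fun x => (Finset.range p).sup fun i => N ((T^[i] 1)⁻¹ * x) with hE
  obtain ⟨g, hg⟩ : ∃ g, ∀ x, E g ≤ E x := ⟨_, fun x => Function.argmin_le E x⟩
  have hmem (i : ℕ) (hi : i < p) (x : FreeGroup α) : N ((T^[i] 1)⁻¹ * x) ≤ E x :=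
    Finset.le_sup (f := fun i => N ((T^[i] 1)⁻¹ * x)) (Finset.mem_range.2 hi)
  have hmap (i : ℕ) (hi : i < p) :
      N ((T^[i + 1] 1)⁻¹ * T g) ≤ E g + 2 * h.norm := by
    rw [Function.iterate_succ_apply', affineMap_inv_mul]
    exact (hN₃ _).trans (Nat.add_le_add_right (hmem i hi g) _)
  have hTg : E (T g) ≤ E g + (N h + 2 * h.norm) := by
    refine Finset.sup_le fun i hi => ?_
    rw [Finset.mem_range] at hi
    -- The orbit closes up only to `T^[p] 1 = h` instead of `1`; the index `0` pays the extra `N h`.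
    rcases i with _ | i
    · have h₁ := hmap (p - 1) (by omega)
      rw [Nat.sub_add_cancel hp, hf] at h₁
      have h₂ := hN₂ h (h⁻¹ * T g)
      rw [mul_inv_cancel_left] at h₂
      simp only [Function.iterate_zero, id_eq, inv_one, one_mul]
      omega
    · have := hmap i (by omega)
      omega
  refine ⟨g, ?_, ?_⟩
  · have h₁ := hmem 0 hp g
    have h₂ := hN₁ g
    simp only [Function.iterate_zero, id_eq, inv_one, one_mul] at h₁
    refine h₂.trans (h₁.trans ((hg 1).trans (Finset.sup_le fun i hi => ?_)))
    rw [Finset.mem_range] at hi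
    rw [mul_one, mul_assoc]
    refine (hN₄ _).trans (Nat.mul_le_mul_left _ ?_)
    rw [norm_inv_eq]
    refine (norm_affineMap_iterate_one_le ψ f (by simpa using hK 1) i).trans ?_
    gcongr
    omega
  · have h₁ := norm_inv_mul_le_of_quasicenter hN₁ hN₅ (Finset.nonempty_range_iff.2 hp.ne')
      (fun i => T^[i] 1) hg hTg
    rw [← norm_inv_eq] at h₁
    simpa [hT, affineMap, mul_assoc] using h₁

theorem finite_norm_le (D : ℕ) : {x : FreeGroup α | x.norm ≤ D}.Finite :=
  (List.finite_length_le (α × Bool) D).preimage toWord_injective.injOn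

/-- A ball contains finitely many pairs; one conjugator is fixed for each twisted conjugate pair,
and `M` bounds their norms. -/
theorem exists_bound_twisted_conj_mem_finite (ψ : MulAut (FreeGroup α)) (D : ℕ) :
    ∃ M : ℕ, ∀ f g : FreeGroup α, f.norm ≤ D → ((ψ g)⁻¹ * f * g).norm ≤ D →
      ∃ g' : FreeGroup α, (ψ g')⁻¹ * f * g' = (ψ g)⁻¹ * f * g ∧ g'.norm ≤ M := by
  classical
  have key (q : FreeGroup α × FreeGroup α) :
      ∃ M : ℕ, (∃ g, (ψ g)⁻¹ * q.1 * g = q.2) → ∃ g, (ψ g)⁻¹ * q.1 * g = q.2 ∧ g.norm ≤ M := by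
    by_cases hq : ∃ g, (ψ g)⁻¹ * q.1 * g = q.2
    · obtain ⟨g, hg⟩ := hq
      exact ⟨g.norm, fun _ => ⟨g, hg, le_rfl⟩⟩
    · exact ⟨0, fun h => absurd h hq⟩
  choose M hM using key
  have hfin := (finite_norm_le (α := α) D).prod (finite_norm_le (α := α) D)
  refine ⟨hfin.toFinset.sup M, fun f g hf hg => ?_⟩
  obtain ⟨g', hg', hle⟩ := hM (f, (ψ g)⁻¹ * f * g) ⟨g, rfl⟩
  exact ⟨g', hg', hle.trans (Finset.le_sup (by simpa using ⟨hf, hg⟩))⟩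

/-- If some power of `ψ` is inner, then `ψ`-twisted conjugate elements are twisted conjugate by an
element of linearly bounded norm. -/
theorem exists_bound_twisted_conj (hp : 0 < p) (hψ : ∀ x, (ψ ^ p) x = h⁻¹ * x * h)
    (hh : ψ h = h) :
    ∃ A : ℕ, ∀ f g : FreeGroup α, ∃ g' : FreeGroup α,
      (ψ g')⁻¹ * f * g' = (ψ g)⁻¹ * f * g ∧
      g'.norm ≤ A * (f.norm + ((ψ g)⁻¹ * f * g).norm + 1) := by
  obtain ⟨A, D, hAD⟩ := exists_norm_twisted_conj_le hp hψ
  obtain ⟨M, hM⟩ := exists_bound_twisted_conj_mem_finite ψ D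
  obtain ⟨K, hK⟩ := exists_norm_map_le ψ.toMonoidHom
  have hK' (f : FreeGroup α) := norm_affineMap_iterate_one_le ψ f hK p
  set B := p * (K + 1) ^ p
  refine ⟨A + B + M + 2 * h.norm, fun f g => ?_⟩
  generalize hf' : (ψ g)⁻¹ * f * g = f'
  have hit := affineMap_iterate_twisted ψ f g p 1
  rw [mul_one, hf', affineMap_iterate_eq f hψ g] at hit
  have hu := map_affineMap_iterate_mul_inv f hψ hh
  by_cases hone : (affineMap ψ f)^[p] 1 = h
  · have hone' : (affineMap ψ f')^[p] 1 = h := by rw [hit, hone]; group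
    obtain ⟨a, ha, ha'⟩ := hAD f hone
    obtain ⟨b, hb, hb'⟩ := hAD f' hone'
    -- Both elements are moved into the ball of radius `D` by `a` and `b`, joined there by a bounded
    -- `c`, and moved back.
    have e : (ψ (a⁻¹ * g * b))⁻¹ * ((ψ a)⁻¹ * f * a) * (a⁻¹ * g * b) = (ψ b)⁻¹ * f' * b := by
      rw [← hf']
      simp only [_root_.map_mul, _root_.map_inv]
      group
    obtain ⟨c, hc, hc'⟩ := hM _ (a⁻¹ * g * b) ha' (by rw [e]; exact hb')
    refine ⟨a * c * b⁻¹, ?_, ?_⟩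
    · rw [e] at hc
      have e' : f' = ψ b * ((ψ b)⁻¹ * f' * b) * b⁻¹ := by group
      rw [e', ← hc]
      simp only [_root_.map_mul, _root_.map_inv]
      group
    · have h₁ := norm_mul_le (a * c) b⁻¹
      have h₂ := norm_mul_le a c
      rw [norm_inv_eq] at h₁
      nlinarith [Nat.zero_le (A * f.norm), Nat.zero_le (B * f.norm), Nat.zero_le (M * f.norm),
        Nat.zero_le (h.norm * f.norm), Nat.zero_le (B * f'.norm), Nat.zero_le (M * f'.norm),
        Nat.zero_le (h.norm * f'.norm)]
  · have hne : (affineMap ψ f)^[p] 1 * h⁻¹ ≠ 1 := by rwa [Ne, mul_inv_eq_one]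
    have hcomm : ((affineMap ψ f)^[p] 1 * h⁻¹) * g = g * ((affineMap ψ f')^[p] 1 * h⁻¹) := by
      rw [hit]; group
    obtain ⟨k, hk⟩ := exists_zpow_mul_norm_le hne hcomm
    have h₁ := norm_mul_le ((affineMap ψ f)^[p] 1) h⁻¹
    have h₂ := norm_mul_le ((affineMap ψ f')^[p] 1) h⁻¹
    rw [norm_inv_eq] at h₁ h₂
    have h₃ := hK' f
    have h₄ := hK' f'
    generalize (affineMap ψ f)^[p] 1 * h⁻¹ = u at *
    refine ⟨u ^ k * g, ?_, ?_⟩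
    · rw [← hf', _root_.map_mul, map_zpow, hu, conj_zpow]
      group
    · nlinarith [Nat.zero_le (A * f.norm), Nat.zero_le (M * f.norm),
        Nat.zero_le (h.norm * f.norm), Nat.zero_le (A * f'.norm), Nat.zero_le (M * f'.norm),
        Nat.zero_le (h.norm * f'.norm)]

end FreeGroup

/-! ### Trivial centre and norms of powers -/

namespace FreeGroup

variable {α : Type*}

theorem IsReduced.cons_append_singleton {L : List (α × Bool)} (hL : L ≠ []) (h : IsReduced L)
    {i : α} (hi : i ≠ (L.head hL).1) :
    IsReduced ((i, !(L.getLast hL).2) :: L ++ [(i, (L.getLast hL).2)]) := by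
  refine IsReduced.append_overlap (L₁ := [(i, !(L.getLast hL).2)]) ?_ ?_ hL
  · rw [IsReduced, List.isChain_append]
    refine ⟨IsReduced.singleton, h, ?_⟩
    intro x hx y hy h
    rw [List.head?_eq_some_head hL] at hy
    simp only [Option.mem_def, Option.some.injEq, List.getLast?_singleton] at hx hy
    subst hx hy
    exact absurd h hi
  · rw [IsReduced, List.isChain_append]
    refine ⟨h, IsReduced.singleton, ?_⟩
    intro x hx y hy h
    rw [List.getLast?_eq_some_getLast hL] at hx
    simp only [Option.mem_def, Option.some.injEq, List.head?_cons] at hx hy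
    subst hx hy
    rfl

variable [DecidableEq α]

theorem eq_one_of_forall_commute [Nontrivial α] {z : FreeGroup α} (hz : ∀ x, Commute z x) :
    z = 1 := by
  by_contra hne
  have hL : z.toWord ≠ [] := by simpa using hne
  -- Conjugating by a letter with this generator and the sign of the last letter of `z` cancels at
  -- neither end, so the norm would grow by two.
  obtain ⟨i, hi⟩ := exists_ne (z.toWord.head hL).1
  have hred := isReduced_toWord.cons_append_singleton hL hi
  set b := z.toWord.getLast hL with hb
  have e : mk ((i, !b.2) :: z.toWord ++ [(i, b.2)]) = z := by
    have h₁ : mk ((i, !b.2) :: z.toWord ++ [(i, b.2)]) =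
        (mk [(i, b.2)])⁻¹ * z * mk [(i, b.2)] := by
      nth_rw 2 [← mk_toWord (x := z)]
      simp [invRev]
    rw [h₁, mul_assoc, (hz _).eq, inv_mul_cancel_left]
  have h := congrArg norm e
  rw [norm, toWord_mk, hred.reduce_eq, norm] at h
  simp at h
  omega

theorem norm_pow_le (x : FreeGroup α) (k : ℕ) : (x ^ k).norm ≤ k * x.norm := by
  induction k with
  | zero => simp
  | succ k ih =>
    rw [pow_succ, Nat.succ_mul]
    exact (norm_mul_le _ _).trans (Nat.add_le_add_right ih _)

theorem norm_zpow_le (x : FreeGroup α) (k : ℤ) : (x ^ k).norm ≤ k.natAbs * x.norm := by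
  rcases Int.natAbs_eq k with h | h
  · nth_rw 1 [h]
    rw [zpow_natCast]
    exact norm_pow_le x _
  · nth_rw 1 [h]
    rw [zpow_neg, zpow_natCast, norm_inv_eq]
    exact norm_pow_le x _

end FreeGroup

/-! ### Uniform bounds over all powers of the automorphism -/

namespace IsVirtuallyInner

open FreeGroup

variable {α : Type*} {φ : MulAut (FreeGroup α)} {m : ℕ} {h : FreeGroup α}

/-- Since `φ` commutes with `φ ^ m`, the element `φ h * h⁻¹` is central, and the centre is trivial.
-/
theorem map_eq_self [DecidableEq α] [Nontrivial α] (hφ : ∀ x, (φ ^ m) x = h⁻¹ * x * h) :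
    φ h = h := by
  rw [← mul_inv_eq_one]
  refine eq_one_of_forall_commute fun x => ?_
  obtain ⟨y, rfl⟩ := φ.surjective x
  have h₁ : (φ ^ m) (φ y) = φ ((φ ^ m) y) := by
    rw [← MulAut.mul_apply, ← MulAut.mul_apply, ← pow_succ, ← pow_succ']
  rw [hφ, hφ] at h₁
  simp only [_root_.map_mul, _root_.map_inv] at h₁
  calc φ h * h⁻¹ * φ y = φ h * (h⁻¹ * φ y * h) * h⁻¹ := by group
    _ = φ y * (φ h * h⁻¹) := by rw [h₁]; group

theorem zpow_apply_zpow (hh : φ h = h) (j q : ℤ) : (φ ^ j) (h ^ q) = h ^ q := by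
  have : φ ∈ MulAction.stabilizer (MulAut (FreeGroup α)) h := hh
  rw [map_zpow]
  congr 1
  exact Subgroup.zpow_mem _ this j

theorem zpow_natCast_mul_apply (hφ : ∀ x, (φ ^ m) x = h⁻¹ * x * h) (q : ℤ) (x : FreeGroup α) :
    (φ ^ ((m : ℤ) * q)) x = h ^ (-q) * x * h ^ q := by
  have e : φ ^ m = MulAut.conj h⁻¹ := by
    ext1 x; rw [hφ]; simp
  rw [zpow_mul, zpow_natCast, e, ← map_zpow, MulAut.conj_apply]
  simp

/-- Bounded twisted conjugators, uniformly for all powers of an automorphism of which some power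
is inner. -/
theorem exists_bound [Finite α] [DecidableEq α] (hm : 0 < m)
    (hφ : ∀ x, (φ ^ m) x = h⁻¹ * x * h) (hh : φ h = h) :
    ∃ A : ℕ, ∀ (l j : ℤ) (f f' g : FreeGroup α), (φ ^ j) f * g = (φ ^ l) g * f' →
      ∃ (r : ℕ) (g' : FreeGroup α), (φ ^ (r : ℤ)) f * g' = (φ ^ l) g' * f' ∧
        r + g'.norm ≤ A * (f.norm + f'.norm + l.natAbs + 1) := by
  have hs (s : ℕ) (x : FreeGroup α) : ((φ ^ s) ^ m) x = (h ^ s)⁻¹ * x * h ^ s := by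
    have := zpow_natCast_mul_apply hφ s x
    rw [← pow_mul, mul_comm, ← zpow_natCast, Nat.cast_mul, this]
    simp
  choose A hA using fun s : ℕ => exists_bound_twisted_conj hm (hs s)
    (by simpa using zpow_apply_zpow hh s s)
  choose K hK using fun r : ℕ => exists_norm_map_le (φ ^ r).toMonoidHom
  change ∀ r x, ((φ ^ r) x).norm ≤ K r * x.norm at hK
  set A₀ := (Finset.range m).sup A
  set K₀ := (Finset.range m).sup K
  refine ⟨m + A₀ * (2 * h.norm + K₀ + 1), fun l j f f' g hg => ?_⟩
  have hm' : (m : ℤ) ≠ 0 := by exact_mod_cast hm.ne'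
  have hmod (j : ℤ) : ∃ (q : ℤ) (r : ℕ), r < m ∧ q.natAbs ≤ j.natAbs ∧
      ∀ x, (φ ^ j) x = h ^ (-q) * (φ ^ r) x * h ^ q := by
    obtain ⟨r, hr⟩ := Int.eq_ofNat_of_zero_le (Int.emod_nonneg j hm')
    have hlt := Int.emod_lt_of_pos j (Int.natCast_pos.2 hm)
    refine ⟨j / m, r, by omega, Int.natAbs_ediv_le_natAbs j m, fun x => ?_⟩
    rw [← zpow_natCast_mul_apply hφ, ← MulAut.mul_apply, ← zpow_natCast, ← zpow_add]
    congr 2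
    have := Int.mul_ediv_add_emod j m
    omega
  obtain ⟨q, r, hr, -, hqr⟩ := hmod j
  obtain ⟨q', s, hs', hq', hqs⟩ := hmod l
  -- Replacing `g` by `h ^ q * g` reduces `j` to its residue; below, reducing `l` to its residue
  -- puts `h ^ q'` in front of both elements, which accounts for `l.natAbs` in the bound.
  have h₁ : (φ ^ r) f * (h ^ q * g) = (φ ^ l) (h ^ q * g) * f' := by
    rw [_root_.map_mul, zpow_apply_zpow hh, mul_assoc, ← hg, hqr]
    group
  have h₂ : ((φ ^ s) (h ^ q * g))⁻¹ * (h ^ q' * (φ ^ r) f) * (h ^ q * g) = h ^ q' * f' := by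
    rw [mul_assoc, mul_assoc, h₁, hqs]
    group
  obtain ⟨g', hg', hle⟩ := hA s (h ^ q' * (φ ^ r) f) (h ^ q * g)
  rw [h₂] at hg' hle
  refine ⟨r, g', ?_, ?_⟩
  · rw [hqs, zpow_natCast]
    rw [mul_assoc, inv_mul_eq_iff_eq_mul] at hg'
    calc (φ ^ r) f * g' = h ^ (-q') * (h ^ q' * (φ ^ r) f * g') := by group
      _ = _ := by rw [hg']; group
  · have b₁ : A s ≤ A₀ := Finset.le_sup (f := A) (Finset.mem_range.2 hs')
    have b₂ : K r ≤ K₀ := Finset.le_sup (f := K) (Finset.mem_range.2 hr)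
    have b₃ : (h ^ q').norm ≤ l.natAbs * h.norm :=
      (norm_zpow_le h q').trans (Nat.mul_le_mul_right _ hq')
    have b₄ : ((φ ^ r) f).norm ≤ K₀ * f.norm := (hK r f).trans (Nat.mul_le_mul_right _ b₂)
    have b₅ := norm_mul_le (h ^ q') ((φ ^ r) f)
    have b₆ := norm_mul_le (h ^ q') f'
    have b₇ : (h ^ q' * (φ ^ r) f).norm + (h ^ q' * f').norm + 1 ≤
        (2 * h.norm + K₀ + 1) * (f.norm + f'.norm + l.natAbs + 1) := by
      generalize l.natAbs = N at *
      nlinarith [Nat.zero_le (h.norm * f.norm), Nat.zero_le (h.norm * f'.norm),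
        Nat.zero_le (K₀ * f'.norm), Nat.zero_le (K₀ * N)]
    have b₈ := hle.trans (Nat.mul_le_mul b₁ b₇)
    rw [add_mul]
    refine add_le_add ?_ (b₈.trans (mul_assoc _ _ _).ge)
    exact hr.le.trans (Nat.le_mul_of_pos_right _ (Nat.succ_pos _))

end IsVirtuallyInner

/-! ### Elements of the extension as `t ^ k * f` -/

namespace SemidirectProduct

variable {F C : Type*} [Group F] [Group C] {φ : MulAut F} {θ : C →* MulAut F} {t : C}

/-- The element `t ^ k * f` of a split extension. -/
def zpowMul (θ : C →* MulAut F) (t : C) (k : ℤ) (f : F) : F ⋊[θ] C := inr (t ^ k) * inl f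

theorem zpowMul_mul_zpowMul (hθ : θ t⁻¹ = φ) (k j : ℤ) (f g : F) :
    zpowMul θ t k f * zpowMul θ t j g = zpowMul θ t (k + j) ((φ ^ j) f * g) := by
  have h : (φ ^ j) f = θ (t ^ j)⁻¹ f := by rw [← hθ, ← map_zpow, inv_zpow]
  rw [h, zpowMul, zpowMul, zpowMul, _root_.map_mul inl, inl_aut, zpow_add, _root_.map_mul]
  simp only [_root_.map_inv]
  group

theorem zpowMul_eq_iff {k l : ℤ} {f g : F} :
    zpowMul θ t k f = zpowMul θ t l g ↔ t ^ k = t ^ l ∧ f = g := by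
  constructor
  · intro h
    have h₁ : t ^ k = t ^ l := by
      simpa only [zpowMul, mul_right, right_inr, right_inl, mul_one] using congrArg right h
    refine ⟨h₁, ?_⟩
    rw [zpowMul, zpowMul, h₁] at h
    exact inl_injective (mul_left_cancel h)
  · rintro ⟨h₁, rfl⟩
    rw [zpowMul, zpowMul, h₁]

theorem exists_eq_zpowMul (ht : ∀ c : C, c ∈ Subgroup.zpowers t) (x : F ⋊[θ] C) :
    ∃ k f, x = zpowMul θ t k f := by
  obtain ⟨k, hk⟩ := ht x.right
  refine ⟨k, θ x.right⁻¹ x.left, ?_⟩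
  change t ^ k = x.right at hk
  rw [zpowMul, hk, inl_aut, inv_inv]
  conv_lhs => rw [← inl_left_mul_inr_right x]
  simp [mul_assoc]

end SemidirectProduct

section SplitExtension

open SemidirectProduct FreeGroup

variable {n : ℕ} {φ : MulAut (FreeGroup (Fin n))} {C : Type*} [Group C] {t : C}
  {θ : C →* MulAut (FreeGroup (Fin n))}

theorem GroupWord.val_append {G : Type*} [Group G] {ι : Type*} (s : ι → G) (u v : GroupWord ι) :
    (u ++ v).val s = u.val s * v.val s := by
  simp [GroupWord.val]

theorem exists_groupWord_val_eq_zpowMul (r : ℕ) (g : FreeGroup (Fin n)) :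
    ∃ v : GroupWord (Option (Fin n)), v.val (splitExtensionGen θ t) = zpowMul θ t r g ∧
      v.length = r + g.norm := by
  refine ⟨List.replicate r (none, true) ++ g.toWord.map fun a => (some a.1, a.2), ?_, ?_⟩
  · rw [GroupWord.val_append, zpowMul]
    congr 1
    · simp [GroupWord.val, splitExtensionGen]
    · have key (L : List (Fin n × Bool)) :
          GroupWord.val (splitExtensionGen θ t) (L.map fun a => (some a.1, a.2)) =
            inl (mk L) := by
        induction L with
        | nil => simp [GroupWord.val, ← one_eq_mk]
        | cons a l ih =>
          have e : mk (a :: l) = mk [a] * mk l := by simp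
          rw [e, _root_.map_mul, ← ih]
          rcases a with ⟨i, _ | _⟩
          · have : mk [(i, false)] = (of i)⁻¹ := rfl
            rw [this]
            simp [GroupWord.val, splitExtensionGen]
          · have : mk [(i, true)] = of i := rfl
            rw [this]
            simp [GroupWord.val, splitExtensionGen]
      rw [key, mk_toWord]
  · simp [FreeGroup.norm]

/-- Conjugate elements of the split extension are conjugate by an element represented by a word
of linearly bounded length. -/
theorem IsVirtuallyInner.exists_bound_groupWord (hn : 2 ≤ n) (hφ : IsVirtuallyInner φ)
    (ht : ∀ c : C, c ∈ Subgroup.zpowers t) (hθ : θ t⁻¹ = φ) :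
    ∃ A : ℕ, ∀ (k l : ℤ) (f f' : FreeGroup (Fin n)),
      IsConj (zpowMul θ t k f) (zpowMul θ t l f') ↔
      ∃ v : GroupWord (Option (Fin n)), v.length ≤ A * (f.norm + f'.norm + l.natAbs + 1) ∧
        zpowMul θ t k f * v.val (splitExtensionGen θ t) =
          v.val (splitExtensionGen θ t) * zpowMul θ t l f' := by
  have : Nontrivial (Fin n) := Fin.nontrivial_iff_two_le.2 hn
  obtain ⟨m, hm, h, hh⟩ := hφ
  have hφ' (x : FreeGroup (Fin n)) : (φ ^ m) x = (h⁻¹)⁻¹ * x * h⁻¹ := by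
    rw [← hh]; simp
  obtain ⟨A, hA⟩ := exists_bound hm hφ' (map_eq_self hφ')
  refine ⟨A, fun k l f f' => ⟨fun hconj => ?_, ?_⟩⟩
  · obtain ⟨c, hc⟩ := isConj_iff.1 hconj
    obtain ⟨j, g, hjg⟩ := exists_eq_zpowMul ht c⁻¹
    have h₁ : zpowMul θ t k f * zpowMul θ t j g = zpowMul θ t j g * zpowMul θ t l f' := by
      rw [← hc, ← hjg]; group
    rw [zpowMul_mul_zpowMul hθ, zpowMul_mul_zpowMul hθ, zpowMul_eq_iff] at h₁
    obtain ⟨r, g', hg', hle⟩ := hA l j f f' g h₁.2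
    obtain ⟨v, hv, hlen⟩ := exists_groupWord_val_eq_zpowMul (θ := θ) (t := t) r g'
    refine ⟨v, hlen.trans_le hle, ?_⟩
    rw [hv, zpowMul_mul_zpowMul hθ, zpowMul_mul_zpowMul hθ, zpowMul_eq_iff]
    refine ⟨?_, hg'⟩
    have h₂ := h₁.1
    rw [zpow_add, add_comm, zpow_add, mul_left_inj] at h₂
    rw [zpow_add, add_comm, zpow_add, h₂]
  · rintro ⟨v, -, hv⟩
    refine isConj_iff.2 ⟨(v.val (splitExtensionGen θ t))⁻¹, ?_⟩
    rw [mul_assoc, inv_inv, hv, inv_mul_cancel_left]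

end SplitExtension

/-! ### Computability of reduction, bounded search and normal forms -/

theorem FreeGroup.reduce_eq_foldr {α : Type*} [DecidableEq α] (L : List (α × Bool)) :
    reduce L = L.foldr (fun a s =>
      List.casesOn s [a] fun b l => if a.1 = b.1 ∧ a.2 = !b.2 then l else a :: b :: l) [] := by
  induction L with
  | nil => rfl
  | cons a l ih => rw [reduce.cons, List.foldr_cons, ← ih]

theorem FreeGroup.primrec_reduce {α : Type*} [DecidableEq α] [Primcodable α] :
    Primrec (reduce : List (α × Bool) → List (α × Bool)) := by
  have hstep : Primrec₂ fun (_ : List (α × Bool)) (p : (α × Bool) × List (α × Bool)) =>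
      (List.casesOn p.2 [p.1] fun b l =>
        if p.1.1 = b.1 ∧ p.1.2 = !b.2 then l else p.1 :: b :: l : List (α × Bool)) := by
    have ha : Primrec fun q : (List (α × Bool) × ((α × Bool) × List (α × Bool))) ×
        ((α × Bool) × List (α × Bool)) => q.1.2.1 :=
      Primrec.fst.comp (Primrec.snd.comp Primrec.fst)
    have hb : Primrec fun q : (List (α × Bool) × ((α × Bool) × List (α × Bool))) ×
        ((α × Bool) × List (α × Bool)) => q.2.1 := Primrec.fst.comp Primrec.snd
    have hl : Primrec fun q : (List (α × Bool) × ((α × Bool) × List (α × Bool))) ×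
        ((α × Bool) × List (α × Bool)) => q.2.2 := Primrec.snd.comp Primrec.snd
    have hcons : Primrec₂ fun (r : List (α × Bool) × ((α × Bool) × List (α × Bool)))
        (c : (α × Bool) × List (α × Bool)) =>
        if r.2.1.1 = c.1.1 ∧ r.2.1.2 = !c.1.2 then c.2 else r.2.1 :: c.1 :: c.2 := by
      refine Primrec.ite (PrimrecPred.and ?_ ?_) hl
        (Primrec.list_cons.comp ha (Primrec.list_cons.comp hb hl))
      · exact Primrec.eq.comp (Primrec.fst.comp ha) (Primrec.fst.comp hb)
      · exact Primrec.eq.comp (Primrec.snd.comp ha) (Primrec.not.comp (Primrec.snd.comp hb))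
    exact Primrec.list_casesOn (Primrec.snd.comp Primrec.snd)
      (Primrec.list_cons.comp (Primrec.fst.comp Primrec.snd) (Primrec.const [])) hcons
  exact (Primrec.list_foldr Primrec.id (Primrec.const []) hstep).of_eq
    fun L => (reduce_eq_foldr L).symm

/-- All lists of length at most `B` over a finite alphabet. -/
noncomputable def List.ofLengthLE (β : Type*) [Fintype β] (B : ℕ) : List (List β) :=
  Nat.rec [[]] (fun _ L => [] :: L.flatMap fun v => Finset.univ.toList.map fun a => a :: v) B

theorem List.mem_ofLengthLE {β : Type*} [Fintype β] {B : ℕ} {v : List β} :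
    v ∈ List.ofLengthLE β B ↔ v.length ≤ B := by
  induction B generalizing v with
  | zero => simp [ofLengthLE]
  | succ B ih =>
    change v ∈ [] :: (List.ofLengthLE β B).flatMap _ ↔ _
    cases v with
    | nil => simp
    | cons a v => simp [ih]

theorem List.primrec_ofLengthLE {β : Type*} [Fintype β] [Primcodable β] :
    Primrec (List.ofLengthLE β) := by
  have hstep : Primrec fun L : List (List β) =>
      [] :: L.flatMap fun v => (Finset.univ : Finset β).toList.map fun a => a :: v := by
    refine Primrec.list_cons.comp (Primrec.const []) (Primrec.list_flatMap Primrec.id ?_)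
    exact Primrec.list_map (Primrec.const _)
      (Primrec.list_cons.comp Primrec.snd (Primrec.snd.comp Primrec.fst))
  exact Primrec.nat_rec₁ _ (hstep.comp Primrec.snd)

/-- A decidable equivalence relation has a computable normal form: the equivalent element with the
smallest code. -/
theorem ComputablePred.exists_normalForm {β : Type*} [Primcodable β] [Inhabited β]
    {R : β → β → Prop} (hR : Equivalence R) (h : ComputablePred fun p : β × β => R p.1 p.2) :
    ∃ nf : β → β, Computable nf ∧ (∀ w, R w (nf w)) ∧ ∀ u v, R u v ↔ nf u = nf v := by
  classical
  let P : β → ℕ → Prop := fun w k => ∃ v, Encodable.decode (α := β) k = some v ∧ R w v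
  have hP : ComputablePred fun p : β × ℕ => P p.1 p.2 := by
    obtain ⟨r, hr, hrR⟩ := ComputablePred.computable_iff.1 h
    have hrR (u v : β) : R u v ↔ r (u, v) = true := iff_of_eq (congrFun hrR (u, v))
    have hpair : Computable fun q : (β × ℕ) × β => (q.1.1, q.2) :=
      (Computable.fst.comp Computable.fst).pair Computable.snd
    have hsome : Computable₂ fun (p : β × ℕ) (v : β) => r (p.1, v) := hr.comp hpair
    have hdecode : Computable fun p : β × ℕ => Encodable.decode (α := β) p.2 :=
      Computable.decode.comp Computable.snd
    refine ComputablePred.computable_iff.2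
      ⟨_, Computable.option_casesOn hdecode (Computable.const false) hsome, funext fun p => ?_⟩
    simp only [P]
    cases Encodable.decode (α := β) p.2 <;> simp [hrR]
  have hex (w : β) : ∃ k, P w k := ⟨Encodable.encode w, w, Encodable.encodek w, hR.refl _⟩
  -- The value `default` is never taken, because the index found decodes by its choice.
  let nf : β → β := fun w => (Encodable.decode (α := β) (Nat.find (hex w))).getD default
  have hnf (w : β) : R w (nf w) := by
    obtain ⟨v, hv, hw⟩ := Nat.find_spec (hex w)
    simpa only [nf, hv, Option.getD_some] using hw
  refine ⟨nf, ?_, hnf, fun u v => ⟨fun huv => ?_, fun huv => ?_⟩⟩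
  · exact Computable.option_getD (Computable.decode.comp (Computable.find hP hex))
      (Computable.const default)
  · have e : P u = P v := by
      funext k
      exact propext ⟨fun ⟨w, hw, h⟩ => ⟨w, hw, hR.trans (hR.symm huv) h⟩,
        fun ⟨w, hw, h⟩ => ⟨w, hw, hR.trans huv h⟩⟩
    simp only [nf, e]
  · exact hR.trans (hnf u) (huv ▸ hR.symm (hnf v))

theorem ConjugacyProblemSolvable.exists_normalForm {G : Type*} [Group G] {ι : Type*}
    [Primcodable ι] {s : ι → G} (h : ConjugacyProblemSolvable s) :
    ∃ nf : GroupWord ι → GroupWord ι, IsComputableConjugacyNormalForm s nf :=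
  ComputablePred.exists_normalForm (R := fun u v : GroupWord ι => IsConj (u.val s) (v.val s))
    ⟨fun _ => IsConj.refl _, IsConj.symm, IsConj.trans⟩ h

/-! ### Word problem and conjugacy search in the extension -/

section SplitExtension

open SemidirectProduct FreeGroup

variable {n : ℕ} (φ : MulAut (FreeGroup (Fin n))) {C : Type*} [Group C] {t : C}
  {θ : C →* MulAut (FreeGroup (Fin n))}

/-- The number of occurrences of the letter `t`, of `t⁻¹`, and the word in the free generators
contributed by a single letter of a split extension. -/
def letterData {n : ℕ} : Option (Fin n) × Bool → ℕ × ℕ × List (Fin n × Bool)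
  | (some i, b) => (0, 0, [(i, b)])
  | (none, true) => (1, 0, [])
  | (none, false) => (0, 1, [])

/-- The integer represented by a pair of natural numbers, used as the exponent of `t`. -/
def texp {n : ℕ} (d : ℕ × ℕ × List (Fin n × Bool)) : ℤ := d.1 - d.2.1

/-- The word obtained by letting a letter act on a free generator or its inverse. -/
def letterImage (c : Option (Fin n) × Bool) (a : Fin n × Bool) : List (Fin n × Bool) :=
  ((φ ^ texp (letterData c)) (mk [a])).toWord

/-- One step of the computation of the form `t ^ (a - b) * f` of a word. -/
def collectStep (d : ℕ × ℕ × List (Fin n × Bool)) (c : Option (Fin n) × Bool) :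
    ℕ × ℕ × List (Fin n × Bool) :=
  (d.1 + (letterData c).1, d.2.1 + (letterData c).2.1,
    d.2.2.flatMap (letterImage φ c) ++ (letterData c).2.2)

/-- Moves all letters `t` of a word to the left. -/
def collect (w : GroupWord (Option (Fin n))) : ℕ × ℕ × List (Fin n × Bool) :=
  w.foldl (collectStep φ) (0, 0, [])

theorem mk_flatMap_toWord {α : Type*} [DecidableEq α] (χ : FreeGroup α →* FreeGroup α)
    (L : List (α × Bool)) : mk (L.flatMap fun a => (χ (mk [a])).toWord) = χ (mk L) := by
  induction L with
  | nil => simp [← one_eq_mk]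
  | cons a l ih =>
    have e : mk (a :: l) = mk [a] * mk l := by simp
    rw [List.flatMap_cons, ← mul_mk, mk_toWord, ih, e, _root_.map_mul]

variable {φ}

theorem zpowMul_collect (hθ : θ t⁻¹ = φ) (w : GroupWord (Option (Fin n))) :
    zpowMul θ t (texp (collect φ w)) (mk (collect φ w).2.2) =
      w.val (splitExtensionGen θ t) := by
  have key (d : ℕ × ℕ × List (Fin n × Bool)) :
      zpowMul θ t (texp (w.foldl (collectStep φ) d)) (mk (w.foldl (collectStep φ) d).2.2) =
        zpowMul θ t (texp d) (mk d.2.2) * w.val (splitExtensionGen θ t) := by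
    induction w generalizing d with
    | nil => simp [GroupWord.val]
    | cons c w ih =>
      have hc : zpowMul θ t (texp (letterData c)) (mk (letterData c).2.2) =
          GroupWord.val (splitExtensionGen θ t) [c] := by
        rcases c with ⟨_ | i, _ | _⟩
        · simp [zpowMul, letterData, texp, GroupWord.val, splitExtensionGen, ← one_eq_mk]
        · simp [zpowMul, letterData, texp, GroupWord.val, splitExtensionGen, ← one_eq_mk]
        · have : mk [(i, false)] = (of i)⁻¹ := rfl
          simp [zpowMul, letterData, texp, GroupWord.val, splitExtensionGen, this]
        · have : mk [(i, true)] = of i := rfl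
          simp [zpowMul, letterData, texp, GroupWord.val, splitExtensionGen, this]
      have hcons : GroupWord.val (splitExtensionGen θ t) (c :: w) =
          GroupWord.val (splitExtensionGen θ t) [c] * GroupWord.val (splitExtensionGen θ t) w :=
        GroupWord.val_append _ [c] w
      have hstep : zpowMul θ t (texp (collectStep φ d c)) (mk (collectStep φ d c).2.2) =
          zpowMul θ t (texp d) (mk d.2.2) *
            zpowMul θ t (texp (letterData c)) (mk (letterData c).2.2) := by
        rw [zpowMul_mul_zpowMul hθ]
        congr 1
        · simp only [texp, collectStep]; push_cast; ring
        · simp only [collectStep, ← mul_mk]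
          congr 1
          exact mk_flatMap_toWord (φ ^ texp (letterData c)).toMonoidHom d.2.2
      rw [List.foldl_cons, ih, hstep, hc, hcons, mul_assoc]
  refine (key (0, 0, [])).trans ?_
  simp [zpowMul, texp, ← one_eq_mk]

theorem primrec_collect : Primrec (collect φ) := by
  have hdata : Primrec fun q : (ℕ × ℕ × List (Fin n × Bool)) × (Option (Fin n) × Bool) =>
      letterData q.2 := (Primrec.dom_finite letterData).comp Primrec.snd
  have himage : Primrec fun q : (Option (Fin n) × Bool) × (Fin n × Bool) =>
      -- There are finitely many pairs of letters, so the action of `φ` and `φ⁻¹` is a finite table.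
      letterImage φ q.1 q.2 := Primrec.dom_finite _
  have hstep : Primrec fun q : (ℕ × ℕ × List (Fin n × Bool)) × (Option (Fin n) × Bool) =>
      collectStep φ q.1 q.2 := by
    refine Primrec.pair ?_ (Primrec.pair ?_ ?_)
    · exact Primrec.nat_add.comp (Primrec.fst.comp Primrec.fst) (Primrec.fst.comp hdata)
    · exact Primrec.nat_add.comp (Primrec.fst.comp (Primrec.snd.comp Primrec.fst))
        (Primrec.fst.comp (Primrec.snd.comp hdata))
    · have hword : Primrec fun q : (ℕ × ℕ × List (Fin n × Bool)) × (Option (Fin n) × Bool) =>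
          q.1.2.2 := Primrec.snd.comp (Primrec.snd.comp Primrec.fst)
      have hact : Primrec₂ fun (q : (ℕ × ℕ × List (Fin n × Bool)) × (Option (Fin n) × Bool))
          (a : Fin n × Bool) => letterImage φ q.2 a :=
        himage.comp (g := fun r : ((ℕ × ℕ × List (Fin n × Bool)) × (Option (Fin n) × Bool)) ×
          (Fin n × Bool) => (r.1.2, r.2)) ((Primrec.snd.comp Primrec.fst).pair Primrec.snd)
      exact Primrec.list_append.comp (Primrec.list_flatMap hword hact)
        (Primrec.snd.comp (Primrec.snd.comp hdata))
  exact Primrec.list_foldl (f := id)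
    (h := fun _ p => collectStep φ p.1 p.2) Primrec.id (Primrec.const _)
    (hstep.comp Primrec.snd)

/-- Cross-adding the counts of `t` and `t⁻¹` keeps exponents in `ℕ`. For `t` of infinite order
`orderOf t = 0`, and reduction modulo `0` is the identity, so one formula covers both cases. -/
theorem val_eq_val_iff (hθ : θ t⁻¹ = φ) (u v : GroupWord (Option (Fin n))) :
    u.val (splitExtensionGen θ t) = v.val (splitExtensionGen θ t) ↔
      ((collect φ u).1 + (collect φ v).2.1) % orderOf t =
        ((collect φ v).1 + (collect φ u).2.1) % orderOf t ∧
      reduce (collect φ u).2.2 = reduce (collect φ v).2.2 := by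
  rw [← zpowMul_collect hθ, ← zpowMul_collect hθ, zpowMul_eq_iff]
  refine and_congr ?_ ⟨reduce.sound, reduce.exact⟩
  generalize collect φ u = d
  generalize collect φ v = e
  change _ ↔ _ ≡ _ [MOD orderOf t]
  rw [← pow_eq_pow_iff_modEq, ← zpow_natCast, ← zpow_natCast,
    ← mul_left_inj (t ^ ((d.2.1 : ℤ) + e.2.1)), ← zpow_add, ← zpow_add]
  have e₁ : texp d + ((d.2.1 : ℤ) + e.2.1) = ((d.1 + e.2.1 : ℕ) : ℤ) := by
    simp only [texp]; push_cast; ring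
  have e₂ : texp e + ((d.2.1 : ℤ) + e.2.1) = ((e.1 + d.2.1 : ℕ) : ℤ) := by
    simp only [texp]; push_cast; ring
  rw [e₁, e₂]

/-- The word problem of a split extension of a free group by a cyclic group. -/
theorem primrecRel_val_eq_val (hθ : θ t⁻¹ = φ) :
    PrimrecRel fun u v : GroupWord (Option (Fin n)) =>
      u.val (splitExtensionGen θ t) = v.val (splitExtensionGen θ t) := by
  have h₁ : Primrec fun p : GroupWord (Option (Fin n)) × GroupWord (Option (Fin n)) =>
      collect φ p.1 := primrec_collect.comp Primrec.fst
  have h₂ : Primrec fun p : GroupWord (Option (Fin n)) × GroupWord (Option (Fin n)) =>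
      collect φ p.2 := primrec_collect.comp Primrec.snd
  refine PrimrecPred.of_eq (PrimrecPred.and ?_ ?_) fun p => (val_eq_val_iff hθ p.1 p.2).symm
  · refine Primrec.eq.comp (Primrec.nat_mod.comp (Primrec.nat_add.comp (Primrec.fst.comp h₁)
      (Primrec.fst.comp (Primrec.snd.comp h₂))) (Primrec.const _))
      (Primrec.nat_mod.comp (Primrec.nat_add.comp (Primrec.fst.comp h₂)
      (Primrec.fst.comp (Primrec.snd.comp h₁))) (Primrec.const _))
  · exact Primrec.eq.comp (primrec_reduce.comp (Primrec.snd.comp (Primrec.snd.comp h₁)))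
      (primrec_reduce.comp (Primrec.snd.comp (Primrec.snd.comp h₂)))

/-- The linear bound turns conjugacy into a finite search for a conjugating word, each candidate
being tested by the word problem. The constant `A` need not be computed, only built into the
algorithm. -/
theorem IsVirtuallyInner.conjugacyProblemSolvable (hn : 2 ≤ n) (hφ : IsVirtuallyInner φ)
    (ht : ∀ c : C, c ∈ Subgroup.zpowers t) (hθ : θ t⁻¹ = φ) :
    ConjugacyProblemSolvable (splitExtensionGen θ t) := by
  obtain ⟨A, hA⟩ := hφ.exists_bound_groupWord hn ht hθ
  let B : GroupWord (Option (Fin n)) × GroupWord (Option (Fin n)) → ℕ := fun p =>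
    A * ((collect φ p.1).2.2.length + (collect φ p.2).2.2.length +
      ((collect φ p.2).1 + (collect φ p.2).2.1) + 1)
  have hB : Primrec B := by
    have h₁ : Primrec fun p : GroupWord (Option (Fin n)) × GroupWord (Option (Fin n)) =>
        collect φ p.1 := primrec_collect.comp Primrec.fst
    have h₂ : Primrec fun p : GroupWord (Option (Fin n)) × GroupWord (Option (Fin n)) =>
        collect φ p.2 := primrec_collect.comp Primrec.snd
    have h₃ := Primrec.list_length.comp (Primrec.snd.comp (Primrec.snd.comp h₁))
    have h₄ := Primrec.list_length.comp (Primrec.snd.comp (Primrec.snd.comp h₂))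
    have h₅ := Primrec.nat_add.comp (Primrec.fst.comp h₂) (Primrec.fst.comp (Primrec.snd.comp h₂))
    exact Primrec.nat_mul.comp (Primrec.const A) (Primrec.nat_add.comp
      (Primrec.nat_add.comp (Primrec.nat_add.comp h₃ h₄) h₅) (Primrec.const 1))
  have hR : PrimrecRel fun (v : GroupWord (Option (Fin n)))
      (p : GroupWord (Option (Fin n)) × GroupWord (Option (Fin n))) =>
      (p.1 ++ v).val (splitExtensionGen θ t) = (v ++ p.2).val (splitExtensionGen θ t) :=
    (primrecRel_val_eq_val hθ).comp
      (Primrec.list_append.comp (Primrec.fst.comp Primrec.snd) Primrec.fst)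
      (Primrec.list_append.comp Primrec.fst (Primrec.snd.comp Primrec.snd))
  have hsearch := hR.exists_mem_list.comp
    (List.primrec_ofLengthLE (β := Option (Fin n) × Bool) |>.comp hB) Primrec.id
  refine hsearch.computablePred.of_eq fun p => ?_
  have hconj := hA (texp (collect φ p.1)) (texp (collect φ p.2)) (mk (collect φ p.1).2.2)
    (mk (collect φ p.2).2.2)
  rw [zpowMul_collect hθ, zpowMul_collect hθ] at hconj
  simp only [List.mem_ofLengthLE, GroupWord.val_append, id_eq]
  refine ⟨fun ⟨v, _, hv⟩ => ?_, fun h => ?_⟩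
  · refine isConj_iff.2 ⟨(v.val (splitExtensionGen θ t))⁻¹, ?_⟩
    rw [mul_assoc, inv_inv, hv, inv_mul_cancel_left]
  · obtain ⟨v, hv, hv'⟩ := hconj.1 h
    -- The search bound uses unreduced lengths and letter counts, which dominate the norms and the
    -- exponent.
    refine ⟨v, hv.trans (Nat.mul_le_mul_left A ?_), hv'⟩
    have h₁ := norm_mk_le (L₁ := (collect φ p.1).2.2)
    have h₂ := norm_mk_le (L₁ := (collect φ p.2).2.2)
    have h₃ : (texp (collect φ p.2)).natAbs ≤ (collect φ p.2).1 + (collect φ p.2).2.1 := by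
      simp only [texp]; omega
    omega

end SplitExtension

/-- `C = ⟨t⟩` is a cyclic group of any finite or infinite order, and conjugation by `t` in
`Fₙ ⋊ ⟨t⟩` induces `φ`, that is `t⁻¹ f t = φ f`. -/
theorem theorem3p1 (n : ℕ) (hn : 2 ≤ n)
    (φ : MulAut (FreeGroup (Fin n))) (hφ : IsVirtuallyInner φ)
    {C : Type*} [Group C] (t : C) (ht : ∀ c : C, c ∈ Subgroup.zpowers t)
    (θ : C →* MulAut (FreeGroup (Fin n)))
    (hθ : ∀ f : FreeGroup (Fin n),
      (SemidirectProduct.inr t : FreeGroup (Fin n) ⋊[θ] C)⁻¹ * SemidirectProduct.inl f *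
        SemidirectProduct.inr t = SemidirectProduct.inl (φ f)) :
    ConjugacyProblemSolvable (splitExtensionGen θ t) ∧
      ∃ nf : GroupWord (Option (Fin n)) → GroupWord (Option (Fin n)),
        IsComputableConjugacyNormalForm (splitExtensionGen θ t) nf := by
  have hθ' : θ t⁻¹ = φ := by
    ext1 f
    apply SemidirectProduct.inl_injective (φ := θ)
    rw [← hθ, SemidirectProduct.inl_aut, inv_inv, _root_.map_inv]
  have h := hφ.conjugacyProblemSolvable hn ht hθ'
  exact ⟨h, h.exists_normalForm⟩
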